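/- Let $(M,g)$ be a smooth Lorentzian manifold of signature $(-,+,\dots,+)$, with Levi-Civita connection $\nabla$, and let $Z$ be a smooth vector field on an open subset $\mathscr U\subseteq M$ that is null ($Z_x\neq 0$ and $g(Z_x,Z_x)=0$ for all $x\in\mathscr U$) and parallel ($\nabla Z=0$). Let $Z_\perp=\{X\in T\mathscr U : g(X,Z)=0\}$ and let $Z_\perp/Z$ be the wavefront bundle, whose fibre at $x$ is $Z_x^\perp/\mathbb R Z_x$; its sections are the classes $[X]$ of smooth vector fields $X\in\Gamma(Z_\perp)$ under $X\sim Y\iff Y=X+fZ$ for some $f\in C^\infty(\mathscr U)$. Then: 1. The formula $\bar g([X],[Y])=g(X,Y)$ gives a well-defined, symmetric, positive-definite inner product on every fibre of $Z_\perp/Z$, and a well-defined $C^\infty(\mathscr U)$-bilinear map $\Gamma(Z_\perp/Z)\times\Gamma(Z_\perp/Z)\to C^\infty(\mathscr U)$. 2. For $V\in\mathfrak X(\mathscr U)$ and $Y\in\Gamma(Z_\perp)$ one has $\nabla_VY\in\Gamma(Z_\perp)$, and the formula $\overline\nabla_V[Y]=[\nabla_VY]$ gives a well-defined linear connection $\overline\nabla:\mathfrak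 X(\mathscr U)\times\Gamma(Z_\perp/Z)\to\Gamma(Z_\perp/Z)$. 3. The connection $\overline\nabla$ is flat (that is, $\overline\nabla_V\overline\nabla_W s-\overline\nabla_W\overline\nabla_V s-\overline\nabla_{[V,W]}s=0$ for all $V,W\in\mathfrak X(\mathscr U)$ and $s\in\Gamma(Z_\perp/Z)$) if and only if the curvature tensor $R$ of $\nabla$ satisfies $R|_{Z_\perp\wedge Z_\perp}=0$, i.e. $R(X,Y)V=0$ for all $X,Y\in\Gamma(Z_\perp)$ and $V\in\mathfrak X(\mathscr U)$. Likewise, $\overline\nabla$ is flat if and only if $(\mathscr U,g|_{\mathscr U})$ is a pp-wave, i.e. admits some smooth null parallel vector field $Z'$ on $\mathscr U$ with $R|_{Z'_\perp\wedge Z'_\perp}=0$. -/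

import Mathlib

open Bundle
open scoped Manifold ContDiff Topology

noncomputable section

namespace PPWave

section Fields

variable (E : Type*) [NormedAddCommGroup E] [NormedSpace ℝ E]
  (N : Type*) [TopologicalSpace N] [ChartedSpace E N]

/-- The ring `C^∞(N)` of smooth real functions on a manifold `N` modelled on `E`. -/
abbrev Fn : Type _ := C^∞⟮𝓘(ℝ, E), N; 𝓘(ℝ, ℝ), ℝ⟯

variable [IsManifold 𝓘(ℝ, E) ∞ N]

/-- The smooth vector fields `𝔛(N)`. -/
abbrev VF : Type _ := Cₛ^∞⟮𝓘(ℝ, E); E, (TangentSpace 𝓘(ℝ, E) : N → Type _)⟯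

variable {E N}

instance : SMul (Fn E N) (VF E N) :=
  ⟨fun f X => ⟨fun x => f x • X x, f.contMDiff.smul_section X.contMDiff⟩⟩

@[simp]
theorem smul_apply (f : Fn E N) (X : VF E N) (x : N) : (f • X) x = f x • X x := rfl

/-- `𝔛(N)` is a `C^∞(N)`-module under pointwise multiplication. -/
instance : Module (Fn E N) (VF E N) where
  one_smul X := by ext x; simp
  mul_smul f h X := by ext x; simp [mul_smul]
  smul_zero f := by ext x; simp
  smul_add f X Y := by ext x; simp
  add_smul f h X := by ext x; simp [add_smul]
  zero_smul X := by ext x; simp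

/-- The derivative `V f` of a function `f` along a vector field `V`. -/
def dirDeriv (V : VF E N) (f : Fn E N) : Fn E N :=
  ⟨fun x => mvfderiv 𝓘(ℝ, E) f x (V x), by
    have h1 := f.contMDiff.contMDiff_tangentMap (m := ∞) (by simp)
    have h2 := h1.comp V.contMDiff
    intro x
    have h3 := (contMDiffAt_totalSpace.1 (h2 x)).2
    simpa [tangentMap, mvfderiv] using! h3⟩

/-- The Lie bracket `[V, W]` of vector fields. -/
def bracket [FiniteDimensional ℝ E] (V W : VF E N) : VF E N :=
  ⟨VectorField.mlieBracket 𝓘(ℝ, E) V W, by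
    have : CompleteSpace E := FiniteDimensional.complete ℝ E
    have : IsManifold 𝓘(ℝ, E) (minSmoothness ℝ 2) N := by
      rw [minSmoothness_of_isRCLikeNormedField]; infer_instance
    have : IsManifold 𝓘(ℝ, E) (((⊤ : ℕ∞) : ℕ∞ω) + 1) N := by
      simpa using (inferInstance : IsManifold 𝓘(ℝ, E) ∞ N)
    exact ContDiff.mlieBracket_vectorField V.contMDiff W.contMDiff (by simp)⟩

end Fields

/-- The differential at `x` of the inclusion of an open set. -/
def dIncl {E : Type*} [NormedAddCommGroup E] [NormedSpace ℝ E]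
    {N : Type*} [TopologicalSpace N] [ChartedSpace E N] (U : TopologicalSpace.Opens N) (x : U) :
    TangentSpace 𝓘(ℝ, E) x →L[ℝ] TangentSpace 𝓘(ℝ, E) (x : N) :=
  mfderiv 𝓘(ℝ, E) 𝓘(ℝ, E) (Subtype.val : U → N) x

theorem dIncl_bijective {E : Type*} [NormedAddCommGroup E] [NormedSpace ℝ E]
    {N : Type*} [TopologicalSpace N] [ChartedSpace E N] (U : TopologicalSpace.Opens N) (x : U) :
    Function.Bijective (dIncl (E := E) U x) := by
  have hd : MDifferentiableAt 𝓘(ℝ, E) 𝓘(ℝ, E) (Subtype.val : U → N) x :=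
    (contMDiff_subtype_val (n := 1)).mdifferentiableAt one_ne_zero
  have hw : writtenInExtChartAt 𝓘(ℝ, E) 𝓘(ℝ, E) x (Subtype.val : U → N)
      =ᶠ[𝓝 (extChartAt 𝓘(ℝ, E) x x)] id := by
    have h1 := TopologicalSpace.Opens.chartAt_subtype_val_symm_eventuallyEq (H := E) U (x := x)
    have h2 : ∀ᶠ y in 𝓝 (chartAt E (x : N) (x : N)), y ∈ (chartAt E (x : N)).target :=
      (chartAt E (x : N)).open_target.mem_nhds (mem_chart_target E (x : N))
    filter_upwards [h1, h2] with y hy hy2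
    have : (Subtype.val ((chartAt E x).symm y) : N) = (chartAt E (x : N)).symm y := hy.symm
    simp [writtenInExtChartAt, this, hy2]
  have : dIncl U x = ContinuousLinearMap.id ℝ E := by
    have h := hd.mfderiv
    simp only [modelWithCornersSelf_coe, Set.range_id, fderivWithin_univ] at h
    exact h.trans (hw.fderiv_eq.trans fderiv_id)
  rw [this]
  exact Function.bijective_id

/-- A family of bilinear forms is smooth if all its values on constant vectors are. -/
theorem contMDiffAt_clm₂ {E : Type*} [NormedAddCommGroup E] [NormedSpace ℝ E]
    [FiniteDimensional ℝ E] {N : Type*} [TopologicalSpace N] [ChartedSpace E N]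
    {f : N → E →L[ℝ] E →L[ℝ] ℝ} {x : N}
    (h : ∀ v w : E, ContMDiffAt 𝓘(ℝ, E) 𝓘(ℝ, ℝ) ∞ (fun y => f y v w) x) :
    ContMDiffAt 𝓘(ℝ, E) 𝓘(ℝ, E →L[ℝ] E →L[ℝ] ℝ) ∞ f x := by
  let b := Module.finBasis ℝ E
  let c := fun i => LinearMap.toContinuousLinearMap (b.coord i)
  have hf : f = fun y => ∑ i, ∑ j, f y (b i) (b j) • (c i).smulRight (c j) := by
    ext y v w
    conv_lhs => rw [← b.sum_repr v, ← b.sum_repr w]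
    simp only [map_sum, map_smul, sum_apply, _root_.smul_apply,
      ContinuousLinearMap.smulRight_apply, smul_eq_mul, Finset.mul_sum]
    rw [Finset.sum_comm]
    refine Finset.sum_congr rfl fun i _ => Finset.sum_congr rfl fun j _ => ?_
    simp only [c, LinearMap.coe_toContinuousLinearMap', Module.Basis.coord_apply]
    ring
  rw [hf]
  refine ContMDiffAt.sum fun i _ => ContMDiffAt.sum fun j _ => (h _ _).smul contMDiffAt_const

section Metric

variable (E : Type*) [NormedAddCommGroup E] [NormedSpace ℝ E]
  (N : Type*) [TopologicalSpace N] [ChartedSpace E N] [IsManifold 𝓘(ℝ, E) ∞ N]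

/-- A smooth Lorentzian metric, of signature `(-, +, …, +)`: in every tangent space there is a
vector `v` with `g(v, v) < 0` on whose orthogonal complement `g` is positive definite. -/
structure LorentzianMetric where
  inner (x : N) : TangentSpace 𝓘(ℝ, E) x →L[ℝ] TangentSpace 𝓘(ℝ, E) x →L[ℝ] ℝ
  symm (x : N) (v w : TangentSpace 𝓘(ℝ, E) x) : inner x v w = inner x w v
  signature (x : N) : ∃ v : TangentSpace 𝓘(ℝ, E) x, inner x v v < 0 ∧
    ∀ w : TangentSpace 𝓘(ℝ, E) x, inner x v w = 0 → w ≠ 0 → 0 < inner x w w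
  contMDiff : ContMDiff 𝓘(ℝ, E) (𝓘(ℝ, E).prod 𝓘(ℝ, E →L[ℝ] E →L[ℝ] ℝ)) ∞
    (fun x ↦ TotalSpace.mk' (E →L[ℝ] E →L[ℝ] ℝ)
      (E := fun x : N => TangentSpace 𝓘(ℝ, E) x →L[ℝ] TangentSpace 𝓘(ℝ, E) x →L[ℝ] ℝ) x (inner x))

variable {E N}

/-- The restriction `g|_U` of a Lorentzian metric to an open set, i.e. its pull-back under the
inclusion. -/
def LorentzianMetric.restrict [FiniteDimensional ℝ E] (g : LorentzianMetric E N)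
    (U : TopologicalSpace.Opens N) :
    LorentzianMetric E U where
  inner x := ((dIncl U x).precomp ℝ) ∘L (g.inner x) ∘L (dIncl U x)
  symm x v w := g.symm _ _ _
  signature x := by
    obtain ⟨v, hv, hw⟩ := g.signature x
    obtain ⟨v', rfl⟩ := (dIncl_bijective (E := E) U x).2 v
    exact ⟨v', hv, fun w h1 h2 => hw _ h1 fun h0 =>
      h2 ((dIncl_bijective (E := E) U x).1 (h0.trans (map_zero _).symm))⟩
  contMDiff := by
    intro x₀
    rw [contMDiffAt_hom_bundle]
    refine ⟨contMDiffAt_id, ?_⟩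
    apply contMDiffAt_clm₂
    intro v w
    have hs : ∀ v : E, ContMDiffAt 𝓘(ℝ, E) (𝓘(ℝ, E).prod 𝓘(ℝ, E)) ∞
        (fun y : U => TotalSpace.mk' E (E := fun y : N => TangentSpace 𝓘(ℝ, E) y) (y : N)
          (dIncl U y ((trivializationAt E (TangentSpace 𝓘(ℝ, E)) x₀).symm y v))) x₀ := by
      intro v
      have hbase := (trivializationAt E (TangentSpace 𝓘(ℝ, E)) x₀).apply_mk_symm
        (FiberBundle.mem_baseSet_trivializationAt' x₀) v
      have h1 := FiberBundle.contMDiffAt_extend 𝓘(ℝ, E) E (k := ∞) (x := x₀)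
        ((trivializationAt E (TangentSpace 𝓘(ℝ, E)) x₀).symm x₀ v)
      have h2 := (contMDiff_subtype_val (I := 𝓘(ℝ, E)) (n := ∞)
        (U := U)).contMDiff_tangentMap (m := ∞) (by simp)
      have h3 := (h2 _).comp x₀ h1
      refine h3.congr_of_eventuallyEq (Filter.Eventually.of_forall fun y => ?_)
      simp only [tangentMap, FiberBundle.extend, dIncl, Function.comp_apply]
      rw [hbase]
    have hg := (g.contMDiff (x₀ : N)).comp x₀ (contMDiff_subtype_val (n := ∞) (U := U) x₀)
    have h := ContMDiffAt.clm_bundle_apply₂ (E₃ := Bundle.Trivial N ℝ) (F₃ := ℝ) hg (hs v) (hs w)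
    have h' := (contMDiffAt_totalSpace.1 h).2
    refine h'.congr_of_eventuallyEq ?_
    filter_upwards [(trivializationAt E (TangentSpace 𝓘(ℝ, E)) x₀).open_baseSet.mem_nhds
      (FiberBundle.mem_baseSet_trivializationAt' x₀)] with y hy
    rw [inCoordinates_apply_eq₂ hy hy (by simp)]
    simp

end Metric

section LeviCivita

variable {E : Type*} [NormedAddCommGroup E] [NormedSpace ℝ E]
  {N : Type*} [TopologicalSpace N] [ChartedSpace E N] [IsManifold 𝓘(ℝ, E) ∞ N]

/-- The right-hand side of the Koszul formula,
`X g(Y, W) + Y g(W, X) - W g(X, Y) + g([X, Y], W) - g([Y, W], X) + g([W, X], Y)`, at `x`. -/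
def koszul (g : LorentzianMetric E N) (X Y W : (x : N) → TangentSpace 𝓘(ℝ, E) x) (x : N) : ℝ :=
  mvfderiv 𝓘(ℝ, E) (fun y => g.inner y (Y y) (W y)) x (X x)
    + mvfderiv 𝓘(ℝ, E) (fun y => g.inner y (W y) (X y)) x (Y x)
    - mvfderiv 𝓘(ℝ, E) (fun y => g.inner y (X y) (Y y)) x (W x)
    + g.inner x (VectorField.mlieBracket 𝓘(ℝ, E) X Y x) (W x)
    - g.inner x (VectorField.mlieBracket 𝓘(ℝ, E) Y W x) (X x)
    + g.inner x (VectorField.mlieBracket 𝓘(ℝ, E) W X x) (Y x)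

open Classical in
/-- The Levi-Civita covariant derivative `∇_X Y` at `x`: the vector `u` given by the Koszul formula
`2 g(u, W) = koszul g X Y W` for all vector fields `W`. -/
def leviCivita (g : LorentzianMetric E N) (X Y : (x : N) → TangentSpace 𝓘(ℝ, E) x) (x : N) :
    TangentSpace 𝓘(ℝ, E) x :=
  if h : ∃ u : TangentSpace 𝓘(ℝ, E) x, ∀ W : (x : N) → TangentSpace 𝓘(ℝ, E) x,
      MDifferentiableAt 𝓘(ℝ, E) (𝓘(ℝ, E).prod 𝓘(ℝ, E))
        (fun y => TotalSpace.mk' E (E := fun y : N => TangentSpace 𝓘(ℝ, E) y) y (W y)) x →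
      2 * g.inner x u (W x) = koszul g X Y W x
  then h.choose else 0

theorem LorentzianMetric.eq_zero_of_inner (g : LorentzianMetric E N) (x : N)
    (u : TangentSpace 𝓘(ℝ, E) x) (h : ∀ w, g.inner x u w = 0) : u = 0 := by
  obtain ⟨v, -, hv⟩ := g.signature x
  by_contra hu
  exact (hv u ((g.symm x v u).trans (h v)) hu).ne' (h u)

theorem LorentzianMetric.mdifferentiableAt_inner (g : LorentzianMetric E N)
    {X Y : (x : N) → TangentSpace 𝓘(ℝ, E) x} {x : N}
    (hX : MDifferentiableAt 𝓘(ℝ, E) (𝓘(ℝ, E).prod 𝓘(ℝ, E))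
      (fun y => TotalSpace.mk' E (E := fun y : N => TangentSpace 𝓘(ℝ, E) y) y (X y)) x)
    (hY : MDifferentiableAt 𝓘(ℝ, E) (𝓘(ℝ, E).prod 𝓘(ℝ, E))
      (fun y => TotalSpace.mk' E (E := fun y : N => TangentSpace 𝓘(ℝ, E) y) y (Y y)) x) :
    MDifferentiableAt 𝓘(ℝ, E) 𝓘(ℝ, ℝ) (fun y => g.inner y (X y) (Y y)) x := by
  have hg := (g.contMDiff x).mdifferentiableAt (by simp)
  have h := MDifferentiableAt.clm_bundle_apply₂ (E₃ := Bundle.Trivial N ℝ) (F₃ := ℝ) hg hX hY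
  exact (mdifferentiableAt_totalSpace _ _ |>.1 h).2

variable [FiniteDimensional ℝ E]

theorem LorentzianMetric.exists_inner_eq (g : LorentzianMetric E N) (x : N)
    (φ : TangentSpace 𝓘(ℝ, E) x →L[ℝ] ℝ) : ∃ u, ∀ w, g.inner x u w = φ w := by
  have : FiniteDimensional ℝ (TangentSpace 𝓘(ℝ, E) x) := inferInstanceAs (FiniteDimensional ℝ E)
  let L : TangentSpace 𝓘(ℝ, E) x →ₗ[ℝ] Module.Dual ℝ (TangentSpace 𝓘(ℝ, E) x) :=
    ContinuousLinearMap.coeLM ℝ ∘ₗ (g.inner x).toLinearMap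
  have hinj : Function.Injective L := by
    refine (injective_iff_map_eq_zero L).2 fun u hu => g.eq_zero_of_inner x u fun w => ?_
    exact congrArg (fun f => f w) hu
  have hsurj : Function.Surjective L :=
    (LinearMap.injective_iff_surjective_of_finrank_eq_finrank
      (Subspace.dual_finrank_eq (K := ℝ)).symm).1 hinj
  obtain ⟨u, hu⟩ := hsurj φ.toLinearMap
  exact ⟨u, fun w => congrArg (fun f => f w) hu⟩

/-- The Koszul expression is tensorial in its last argument. -/
theorem koszul_tensorial (g : LorentzianMetric E N)
    {X Y : (x : N) → TangentSpace 𝓘(ℝ, E) x} {x : N}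
    (hX : MDifferentiableAt 𝓘(ℝ, E) (𝓘(ℝ, E).prod 𝓘(ℝ, E))
      (fun y => TotalSpace.mk' E (E := fun y : N => TangentSpace 𝓘(ℝ, E) y) y (X y)) x)
    (hY : MDifferentiableAt 𝓘(ℝ, E) (𝓘(ℝ, E).prod 𝓘(ℝ, E))
      (fun y => TotalSpace.mk' E (E := fun y : N => TangentSpace 𝓘(ℝ, E) y) y (Y y)) x) :
    TensorialAt 𝓘(ℝ, E) E (fun W : (x : N) → TangentSpace 𝓘(ℝ, E) x => koszul g X Y W x) x where
  smul {f W} hf hW := by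
    have : CompleteSpace E := FiniteDimensional.complete ℝ E
    have h1 : (fun y => g.inner y (Y y) ((f • W) y)) = fun y => f y * g.inner y (Y y) (W y) := by
      ext y; simp
    have h2 : (fun y => g.inner y ((f • W) y) (X y)) = fun y => f y * g.inner y (W y) (X y) := by
      ext y; simp
    have h3 := mvfderiv_fun_mul hf (g.mdifferentiableAt_inner hY hW)
    have h4 := mvfderiv_fun_mul hf (g.mdifferentiableAt_inner hW hX)
    simp only [koszul, h1, h2, h3, h4, VectorField.mlieBracket_smul_right hf hW,
      VectorField.mlieBracket_smul_left hf hW]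
    simp
    rw [g.symm x (Y x) (W x)]
    ring
  add {W W'} hW hW' := by
    have : CompleteSpace E := FiniteDimensional.complete ℝ E
    have h1 : (fun y => g.inner y (Y y) ((W + W') y))
        = fun y => g.inner y (Y y) (W y) + g.inner y (Y y) (W' y) := by
      ext y; simp
    have h2 : (fun y => g.inner y ((W + W') y) (X y))
        = fun y => g.inner y (W y) (X y) + g.inner y (W' y) (X y) := by
      ext y; simp
    have h3 := mvfderiv_fun_add (g.mdifferentiableAt_inner hY hW) (g.mdifferentiableAt_inner hY hW')
    have h4 := mvfderiv_fun_add (g.mdifferentiableAt_inner hW hX) (g.mdifferentiableAt_inner hW' hX)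
    simp only [koszul, h1, h2, h3, h4, VectorField.mlieBracket_add_right hW hW',
      VectorField.mlieBracket_add_left hW hW']
    simp
    ring

/-- The Koszul formula holds, so `leviCivita` never takes its default value on differentiable
vector fields. -/
theorem leviCivita_spec (g : LorentzianMetric E N)
    {X Y W : (x : N) → TangentSpace 𝓘(ℝ, E) x} {x : N}
    (hX : MDifferentiableAt 𝓘(ℝ, E) (𝓘(ℝ, E).prod 𝓘(ℝ, E))
      (fun y => TotalSpace.mk' E (E := fun y : N => TangentSpace 𝓘(ℝ, E) y) y (X y)) x)
    (hY : MDifferentiableAt 𝓘(ℝ, E) (𝓘(ℝ, E).prod 𝓘(ℝ, E))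
      (fun y => TotalSpace.mk' E (E := fun y : N => TangentSpace 𝓘(ℝ, E) y) y (Y y)) x)
    (hW : MDifferentiableAt 𝓘(ℝ, E) (𝓘(ℝ, E).prod 𝓘(ℝ, E))
      (fun y => TotalSpace.mk' E (E := fun y : N => TangentSpace 𝓘(ℝ, E) y) y (W y)) x) :
    2 * g.inner x (leviCivita g X Y x) (W x) = koszul g X Y W x := by
  have h := koszul_tensorial g hX hY
  obtain ⟨u, hu⟩ := g.exists_inner_eq x ((1 / 2 : ℝ) • TensorialAt.mkHom _ x h)
  have hex : ∃ u : TangentSpace 𝓘(ℝ, E) x, ∀ W : (x : N) → TangentSpace 𝓘(ℝ, E) x,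
      MDifferentiableAt 𝓘(ℝ, E) (𝓘(ℝ, E).prod 𝓘(ℝ, E))
        (fun y => TotalSpace.mk' E (E := fun y : N => TangentSpace 𝓘(ℝ, E) y) y (W y)) x →
      2 * g.inner x u (W x) = koszul g X Y W x := by
    refine ⟨u, fun W hW => ?_⟩
    rw [hu, ← TensorialAt.mkHom_apply h hW, _root_.smul_apply, smul_eq_mul]
    ring
  rw [leviCivita, dif_pos hex]
  exact hex.choose_spec W hW

/-- `∇` is torsion free: `∇_X Y - ∇_Y X = [X, Y]`. -/
theorem leviCivita_torsion (g : LorentzianMetric E N) (X Y : VF E N) (x : N) :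
    leviCivita g X Y x - leviCivita g Y X x = bracket X Y x := by
  rw [← sub_eq_zero]
  refine g.eq_zero_of_inner x _ fun w => ?_
  have hW := FiberBundle.mdifferentiableAt_extend 𝓘(ℝ, E) E w
  have h1 := leviCivita_spec g X.mdifferentiableAt Y.mdifferentiableAt hW
  have h2 := leviCivita_spec g Y.mdifferentiableAt X.mdifferentiableAt hW
  have hc : ∀ A B : (x : N) → TangentSpace 𝓘(ℝ, E) x,
      (fun y => g.inner y (A y) (B y)) = fun y => g.inner y (B y) (A y) := fun A B => by
    ext y; exact g.symm _ _ _
  simp only [koszul, FiberBundle.extend_apply_self] at h1 h2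
  rw [hc Y (FiberBundle.extend E w), hc X Y,
    VectorField.mlieBracket_swap_apply (V := Y) (W := FiberBundle.extend E w)] at h1
  rw [hc X (FiberBundle.extend E w),
    VectorField.mlieBracket_swap_apply (V := X) (W := FiberBundle.extend E w),
    VectorField.mlieBracket_swap_apply (V := Y) (W := X)] at h2
  have hb : bracket X Y x = VectorField.mlieBracket 𝓘(ℝ, E) X Y x := rfl
  rw [hb]
  simp at h1 h2 ⊢
  linarith

/-- `∇` is metric: `X g(Y, W) = g(∇_X Y, W) + g(Y, ∇_X W)`. -/
theorem leviCivita_metric (g : LorentzianMetric E N) (X Y W : VF E N) (x : N) :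
    mvfderiv 𝓘(ℝ, E) (fun y => g.inner y (Y y) (W y)) x (X x)
      = g.inner x (leviCivita g X Y x) (W x) + g.inner x (Y x) (leviCivita g X W x) := by
  have h1 := leviCivita_spec g X.mdifferentiableAt Y.mdifferentiableAt W.mdifferentiableAt (x := x)
  have h2 := leviCivita_spec g X.mdifferentiableAt W.mdifferentiableAt Y.mdifferentiableAt (x := x)
  have hc : ∀ A B : (x : N) → TangentSpace 𝓘(ℝ, E) x,
      (fun y => g.inner y (A y) (B y)) = fun y => g.inner y (B y) (A y) := fun A B => by
    ext y; exact g.symm _ _ _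
  rw [g.symm x (Y x)]
  simp only [koszul] at h1 h2
  rw [hc W X, VectorField.mlieBracket_swap_apply (V := W) (W := X)] at h1
  rw [hc W Y, hc Y X, VectorField.mlieBracket_swap_apply (V := W) (W := Y),
    VectorField.mlieBracket_swap_apply (V := Y) (W := X)] at h2
  simp at h1 h2
  linarith

end LeviCivita

section Wavefront

variable {E : Type*} [NormedAddCommGroup E] [NormedSpace ℝ E]
  {N : Type*} [TopologicalSpace N] [ChartedSpace E N] [IsManifold 𝓘(ℝ, E) ∞ N]
  (g : LorentzianMetric E N) (Z : VF E N)

/-- `Z` is null; the zero vector does not count as null, so `Z` vanishes nowhere. -/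
def IsNull : Prop := ∀ x, Z x ≠ 0 ∧ g.inner x (Z x) (Z x) = 0

/-- `Z` is parallel (covariantly constant): `∇ Z = 0`. -/
def IsParallel : Prop := ∀ (V : VF E N) (x : N), leviCivita g V Z x = 0

/-- The fibre of `Z_⊥` at `x`. -/
def perpAt (x : N) : Submodule ℝ (TangentSpace 𝓘(ℝ, E) x) where
  carrier := {v | g.inner x v (Z x) = 0}
  add_mem' {v w} hv hw := by
    have hv : g.inner x v (Z x) = 0 := hv
    have hw : g.inner x w (Z x) = 0 := hw
    simp [hv, hw]
  zero_mem' := by simp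
  smul_mem' c v hv := by
    have hv : g.inner x v (Z x) = 0 := hv
    simp [hv]

/-- The fibre of the wavefront bundle `Z_⊥ / Z` at `x`. -/
abbrev WavefrontAt (x : N) : Type _ :=
  perpAt g Z x ⧸ (Submodule.span ℝ {Z x}).submoduleOf (perpAt g Z x)

/-- The class in `Z_⊥ / Z` of a tangent vector orthogonal to `Z`. -/
def clsAt {x : N} (v : perpAt g Z x) : WavefrontAt g Z x := Submodule.Quotient.mk v

/-- The `C^∞(N)`-module `Γ(Z_⊥)` of smooth vector fields orthogonal to `Z`. -/
def perp : Submodule (Fn E N) (VF E N) where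
  carrier := {X | ∀ x, g.inner x (X x) (Z x) = 0}
  add_mem' {X Y} hX hY x := by simp [hX x, hY x]
  zero_mem' x := by simp
  smul_mem' f X hX x := by simp [hX x]

/-- The value at `x` of a section of `Z_⊥`. -/
def evalAt (X : perp g Z) (x : N) : perpAt g Z x := ⟨X.1 x, X.2 x⟩

/-- The `C^∞(N)`-module `Γ(Z_⊥ / Z)`: vector fields orthogonal to `Z`, where `X ∼ Y` if and only if
`Y = X + f Z` for some smooth function `f`. -/
abbrev Wavefront : Type _ :=
  perp g Z ⧸ (Submodule.span (Fn E N) {Z}).submoduleOf (perp g Z)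

/-- The class `[X]` in `Γ(Z_⊥ / Z)` of a vector field orthogonal to `Z`. -/
def cls (X : perp g Z) : Wavefront g Z := Submodule.Quotient.mk X

theorem cls_eq_iff (X Y : perp g Z) :
    cls g Z X = cls g Z Y ↔ ∃ f : Fn E N, Y.1 = X.1 + f • Z := by
  rw [cls, cls, eq_comm, Submodule.Quotient.eq, Submodule.submoduleOf, Submodule.mem_comap,
    Submodule.mem_span_singleton]
  simp only [Submodule.subtype_apply, AddSubgroupClass.coe_sub]
  exact exists_congr fun f => ⟨fun h => by rw [h]; abel, fun h => by rw [h]; abel⟩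

end Wavefront

section Connection

variable (E : Type*) [NormedAddCommGroup E] [NormedSpace ℝ E]
  (N : Type*) [TopologicalSpace N] [ChartedSpace E N] [IsManifold 𝓘(ℝ, E) ∞ N]
  (Γ : Type*) [AddCommGroup Γ] [Module (Fn E N) Γ]

/-- A linear connection `𝔛(N) × Γ → Γ` on a module `Γ` of sections: `C^∞(N)`-linear in the
vector field, additive in the section, and satisfying the Leibniz rule. -/
structure LinearConnection where
  toFun : VF E N → Γ → Γ
  add_left (V W : VF E N) (s : Γ) : toFun (V + W) s = toFun V s + toFun W s
  smul_left (f : Fn E N) (V : VF E N) (s : Γ) : toFun (f • V) s = f • toFun V s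
  add_right (V : VF E N) (s t : Γ) : toFun V (s + t) = toFun V s + toFun V t
  leibniz (V : VF E N) (f : Fn E N) (s : Γ) : toFun V (f • s) = f • toFun V s + dirDeriv V f • s

variable {E N Γ} [FiniteDimensional ℝ E]

/-- A connection is flat if its curvature endomorphisms vanish. -/
def LinearConnection.IsFlat (D : LinearConnection E N Γ) : Prop :=
  ∀ (V W : VF E N) (s : Γ),
    D.toFun V (D.toFun W s) - D.toFun W (D.toFun V s) - D.toFun (bracket V W) s = 0

/-- The curvature `R(X, Y) V = ∇_X ∇_Y V - ∇_Y ∇_X V - ∇_[X, Y] V` of the Levi-Civita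
connection. -/
def curvature (g : LorentzianMetric E N) (X Y V : VF E N) (x : N) : TangentSpace 𝓘(ℝ, E) x :=
  leviCivita g X (leviCivita g Y V) x - leviCivita g Y (leviCivita g X V) x
    - leviCivita g (bracket X Y) V x

/-- The condition `R|_{Z_⊥ ∧ Z_⊥} = 0`: `R(X, Y) V = 0` for all `X, Y` orthogonal to `Z` and
all `V`. -/
def CurvatureVanishesOnPerp (g : LorentzianMetric E N) (Z : VF E N) : Prop :=
  ∀ X ∈ perp g Z, ∀ Y ∈ perp g Z, ∀ (V : VF E N) (x : N), curvature g X Y V x = 0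

/-- `(N, g)` is a pp-wave: it admits a global parallel null vector field `Z` such that
`R|_{Z_⊥ ∧ Z_⊥} = 0`. -/
def IsPPWave (g : LorentzianMetric E N) : Prop :=
  ∃ Z : VF E N, IsNull g Z ∧ IsParallel g Z ∧ CurvatureVanishesOnPerp g Z

end Connection

end PPWave

end

open PPWave

/-!
The Levi-Civita connection `∇` of a parallel field `Z` preserves `Z_⊥` and the multiples of `Z`, so
it descends to `Z_⊥ / Z`, and the induced connection is flat exactly when every `R(V, W)` maps
`Z_⊥` into the multiples of `Z`. By the pair symmetry `g(R(V, W) X, Y) = g(R(X, Y) V, W)` this is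
dual to the vanishing of `R` on `Z_⊥ ∧ Z_⊥`: vectors in `Z_⊥` are orthogonal to `Z`, and
conversely `R(V, W) X` lies in `Z_⊥`, where the null vectors are the multiples of `Z`.

If `Z'` is another null field with `R = 0` on `Z'_⊥ ∧ Z'_⊥`, then at each point either `Z'` is a
multiple of `Z`, so that `Z'_⊥ = Z_⊥`, or `Z` is transverse to `Z'_⊥`; in the second case `R`
vanishes altogether at that point, because pair symmetry and `∇ Z = 0` give `R(Z, ·) = 0`.
-/

noncomputable section

namespace PPWave

section LinearMaps

variable {𝕜 : Type*} [NontriviallyNormedField 𝕜] [CompleteSpace 𝕜]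
  {F : Type*} [NormedAddCommGroup F] [NormedSpace 𝕜 F] [FiniteDimensional 𝕜 F]

theorem contMDiffAt_clm_of_apply {E : Type*} [NormedAddCommGroup E] [NormedSpace 𝕜 E]
    {H : Type*} [TopologicalSpace H] {I : ModelWithCorners 𝕜 E H} {N : Type*} [TopologicalSpace N]
    [ChartedSpace H N] {G : Type*} [NormedAddCommGroup G]
    [NormedSpace 𝕜 G] {n : ℕ∞ω} {f : N → F →L[𝕜] G} {x : N}
    (h : ∀ v, ContMDiffAt I 𝓘(𝕜, G) n (fun y => f y v) x) :
    ContMDiffAt I 𝓘(𝕜, F →L[𝕜] G) n f x := by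
  let e₁ : F ≃L[𝕜] (Fin (Module.finrank 𝕜 F) → 𝕜) := ContinuousLinearEquiv.ofFinrankEq (by simp)
  let e₂ := (e₁.arrowCongr (1 : G ≃L[𝕜] G)).trans (ContinuousLinearEquiv.piRing _)
  have he : ContMDiffAt I 𝓘(𝕜, _) n (fun y => e₂ (f y)) x := contMDiffAt_pi_space.2 fun i => h _
  simpa [Function.comp_def] using e₂.symm.contDiff.contMDiff.contMDiffAt.comp x he

theorem isInvertible_of_separatingLeft {B : F →L[𝕜] F →L[𝕜] 𝕜}
    (hB : ∀ v, (∀ w, B v w = 0) → v = 0) : B.IsInvertible := by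
  have hinj : Function.Injective B :=
    (injective_iff_map_eq_zero B).2 fun v hv => hB v fun w => by simp [hv]
  have hrank : Module.finrank 𝕜 F = Module.finrank 𝕜 (F →L[𝕜] 𝕜) :=
    (Subspace.dual_finrank_eq (K := 𝕜)).symm.trans LinearMap.toContinuousLinearMap.finrank_eq
  exact ⟨(LinearEquiv.ofInjectiveOfFinrankEq B.toLinearMap hinj hrank).toContinuousLinearEquiv,
    rfl⟩

end LinearMaps

section SmoothSections

variable {E : Type*} [NormedAddCommGroup E] [NormedSpace ℝ E] {H : Type*} [TopologicalSpace H]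
  {I : ModelWithCorners ℝ E H} {N : Type*} [TopologicalSpace N] [ChartedSpace H N]
  {F : Type*} [NormedAddCommGroup F] [NormedSpace ℝ F]
  {V : N → Type*} [TopologicalSpace (TotalSpace F V)] [∀ x, AddCommGroup (V x)]
  [∀ x, Module ℝ (V x)] [∀ x, TopologicalSpace (V x)] [FiberBundle F V]

theorem exists_contMDiffSection_eventuallyEq_extend [FiniteDimensional ℝ E] [T2Space N]
    [IsManifold I ∞ N] [VectorBundle ℝ F V] [ContMDiffVectorBundle ∞ F V I] {x : N} (v : V x) :
    ∃ s : Cₛ^∞⟮I; F, V⟯, ∀ᶠ y in 𝓝 x, s y = FiberBundle.extend F v y := by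
  obtain ⟨t, ht, hsmooth⟩ := FiberBundle.exists_contMDiffOn_extend I F (k := ∞) v
  obtain ⟨u, hut, hu, hxu⟩ := mem_nhds_iff.1 ht
  obtain ⟨f, -, hf⟩ := (SmoothBumpFunction.nhds_basis_tsupport (I := I) x).mem_iff.1
    (hu.mem_nhds hxu)
  have hs := ContMDiffOn.smul_section_of_tsupport f.contMDiff.contMDiffOn hu hf (hsmooth.mono hut)
  refine ⟨⟨_, hs⟩, ?_⟩
  filter_upwards [f.eventuallyEq_one] with y hy
  exact (congrArg (· • FiberBundle.extend F v y) hy).trans (one_smul ℝ _)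

theorem exists_contMDiffSection_apply_eq [FiniteDimensional ℝ E] [T2Space N]
    [IsManifold I ∞ N] [VectorBundle ℝ F V] [ContMDiffVectorBundle ∞ F V I] {x : N} (v : V x) :
    ∃ s : Cₛ^∞⟮I; F, V⟯, s x = v := by
  obtain ⟨s, hs⟩ := exists_contMDiffSection_eventuallyEq_extend (I := I) (F := F) v
  exact ⟨s, by simpa using hs.self_of_nhds⟩

theorem contMDiffAt_of_smul_section [VectorBundle ℝ F V] {n : ℕ∞ω} {f : N → ℝ} {s : ∀ x, V x}
    {x : N} (hs : CMDiffAt n (T% s) x) (hfs : CMDiffAt n (T% (f • s)) x) (hx : s x ≠ 0) :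
    CMDiffAt n f x := by
  set t := trivializationAt F V x
  have hxt : x ∈ t.baseSet := FiberBundle.mem_baseSet_trivializationAt' x
  have hne : (t ⟨x, s x⟩).2 ≠ 0 := fun h => hx ((t.linearEquivAt ℝ x hxt).map_eq_zero_iff.1 h)
  obtain ⟨φ, hφ⟩ := SeparatingDual.exists_eq_one (R := ℝ) hne
  have hcoord {σ : ∀ x, V x} (hσ : CMDiffAt n (T% σ) x) :
      CMDiffAt n (fun y => φ (t ⟨y, σ y⟩).2) x :=
    φ.contMDiff.contMDiffAt.comp x ((contMDiffAt_section x).1 hσ)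
  have hφ_ne : φ (t ⟨x, s x⟩).2 ≠ 0 := hφ ▸ one_ne_zero
  refine ((hcoord hfs).div₀ (hcoord hs) hφ_ne).congr_of_eventuallyEq ?_
  filter_upwards [t.open_baseSet.mem_nhds hxt,
    (hcoord hs).continuousAt.eventually_ne hφ_ne] with y hyt hy
  rw [Pi.div_apply, eq_div_iff hy, Pi.smul_apply', (t.linear ℝ hyt).map_smul, map_smul,
    smul_eq_mul]

end SmoothSections

section VectorFields

variable {E : Type*} [NormedAddCommGroup E] [NormedSpace ℝ E]
  {N : Type*} [TopologicalSpace N] [ChartedSpace E N]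

theorem Fn.mdifferentiableAt (f : Fn E N) (x : N) : MDifferentiableAt 𝓘(ℝ, E) 𝓘(ℝ, ℝ) f x :=
  (f.contMDiff x).mdifferentiableAt (by simp)

instance : IsAddTorsionFree (Fn E N) :=
  DFunLike.coe_injective.isAddTorsionFree (ContMDiffMap.coeFnAddMonoidHom)

variable [IsManifold 𝓘(ℝ, E) ∞ N]

theorem dirDeriv_apply (V : VF E N) (f : Fn E N) (x : N) :
    dirDeriv V f x = mvfderiv 𝓘(ℝ, E) f x (V x) := rfl

theorem dirDeriv_add_left (V W : VF E N) (f : Fn E N) :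
    dirDeriv (V + W) f = dirDeriv V f + dirDeriv W f := by
  ext x; simp [dirDeriv_apply]

theorem dirDeriv_smul_left (h : Fn E N) (V : VF E N) (f : Fn E N) :
    dirDeriv (h • V) f = h * dirDeriv V f := by
  ext x; simp [dirDeriv_apply]

theorem dirDeriv_add (V : VF E N) (f h : Fn E N) :
    dirDeriv V (f + h) = dirDeriv V f + dirDeriv V h := by
  ext x
  simp [dirDeriv_apply, mvfderiv_add (f.mdifferentiableAt x) (h.mdifferentiableAt x)]

theorem dirDeriv_mul (V : VF E N) (f h : Fn E N) :
    dirDeriv V (f * h) = f * dirDeriv V h + dirDeriv V f * h := by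
  ext x
  simp [dirDeriv_apply, mvfderiv_mul (f.mdifferentiableAt x) (h.mdifferentiableAt x), mul_comm]

theorem dirDeriv_zero (V : VF E N) : dirDeriv V (0 : Fn E N) = 0 := by
  simpa using dirDeriv_add V 0 0

variable [FiniteDimensional ℝ E]

/-- Mathlib's notation `⁅V, W⁆` for the Lie bracket `bracket V W` of vector fields. -/
instance : Bracket (VF E N) (VF E N) := ⟨bracket⟩

theorem lie_apply (V W : VF E N) (x : N) : ⁅V, W⁆ x = VectorField.mlieBracket 𝓘(ℝ, E) V W x := rfl

/-- Only the ring structure: the bracket is `ℝ`-bilinear but not `C^∞(N)`-bilinear. -/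
instance : LieRing (VF E N) where
  add_lie U V W := by
    have := FiniteDimensional.complete ℝ E
    ext x
    exact VectorField.mlieBracket_add_left U.mdifferentiableAt V.mdifferentiableAt
  lie_add U V W := by
    have := FiniteDimensional.complete ℝ E
    ext x
    exact VectorField.mlieBracket_add_right V.mdifferentiableAt W.mdifferentiableAt
  lie_self V := by ext x; simp [lie_apply]
  leibniz_lie U V W := by
    have := FiniteDimensional.complete ℝ E
    have : IsManifold 𝓘(ℝ, E) (minSmoothness ℝ 3) N := by
      rw [minSmoothness_of_isRCLikeNormedField]
      exact IsManifold.of_le (n := ∞) (WithTop.coe_le_coe.2 le_top)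
    have h2 : minSmoothness ℝ 2 ≤ ∞ := by
      rw [minSmoothness_of_isRCLikeNormedField]
      exact WithTop.coe_le_coe.2 le_top
    ext x
    exact VectorField.leibniz_identity_mlieBracket_apply ((U.contMDiff x).of_le h2)
      ((V.contMDiff x).of_le h2) ((W.contMDiff x).of_le h2)

theorem lie_fn_smul (V : VF E N) (f : Fn E N) (W : VF E N) :
    ⁅V, f • W⁆ = dirDeriv V f • W + f • ⁅V, W⁆ := by
  have := FiniteDimensional.complete ℝ E
  ext x
  exact VectorField.mlieBracket_smul_right (f.mdifferentiableAt x) W.mdifferentiableAt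

theorem fn_smul_lie (f : Fn E N) (V W : VF E N) :
    ⁅f • V, W⁆ = f • ⁅V, W⁆ - dirDeriv W f • V := by
  rw [← lie_skew, lie_fn_smul, ← lie_skew V W]
  module

theorem dirDeriv_lie [T2Space N] (V W : VF E N) (f : Fn E N) :
    dirDeriv ⁅V, W⁆ f = dirDeriv V (dirDeriv W f) - dirDeriv W (dirDeriv V f) := by
  -- Compare the coefficients of `X` in the Jacobi identity for `V`, `W` and `f • X`.
  have hsmul (X : VF E N) :
      dirDeriv ⁅V, W⁆ f • X = (dirDeriv V (dirDeriv W f) - dirDeriv W (dirDeriv V f)) • X := by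
    have h := lie_lie V W (f • X)
    simp only [lie_fn_smul, lie_add, lie_lie V W X] at h
    linear_combination (norm := module) h
  ext x
  obtain hE | hE := subsingleton_or_nontrivial (TangentSpace 𝓘(ℝ, E) x)
  · have hzero (V : VF E N) (f : Fn E N) : dirDeriv V f x = 0 := by
      rw [dirDeriv_apply, Subsingleton.elim (V x) 0, map_zero]
    simp only [ContMDiffMap.coe_sub, Pi.sub_apply, hzero, sub_zero]
  · obtain ⟨v, hv⟩ := exists_ne (0 : TangentSpace 𝓘(ℝ, E) x)
    obtain ⟨X, rfl⟩ := exists_contMDiffSection_apply_eq (I := 𝓘(ℝ, E)) (F := E) v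
    exact smul_left_injective ℝ hv (DFunLike.congr_fun (hsmul X) x)

end VectorFields

theorem eq_swap_pairs_of_bianchi {ι A : Type*} [AddCommGroup A] [IsAddTorsionFree A]
    {R : ι → ι → ι → ι → A} (skew_left : ∀ a b c d, R a b c d = -R b a c d)
    (skew_right : ∀ a b c d, R a b c d = -R a b d c)
    (bianchi : ∀ a b c d, R a b c d + R b c a d + R c a b d = 0) (a b c d : ι) :
    R a b c d = R c d a b := by
  -- The skew symmetries turn the alternating sum of these four Bianchi identities into the claim.
  have key : 2 • R a b c d = 2 • R c d a b := by
    linear_combination (norm := module) bianchi a b c d + bianchi b c d a - bianchi c d a b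
      - bianchi d a b c - skew_right b c d a - skew_right c d b a + skew_left a c d b
      - skew_right c a d b + skew_right d a b c + skew_right a b d c + skew_left b d a c
      - skew_right d b a c
  exact nsmul_right_injective two_ne_zero key

section LinearConnections

variable {E : Type*} [NormedAddCommGroup E] [NormedSpace ℝ E]
  {N : Type*} [TopologicalSpace N] [ChartedSpace E N] [IsManifold 𝓘(ℝ, E) ∞ N]
  {Γ : Type*} [AddCommGroup Γ] [Module (Fn E N) Γ]

namespace LinearConnection

theorem map_zero (D : LinearConnection E N Γ) (V : VF E N) : D.toFun V 0 = 0 :=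
  (AddMonoidHom.mk' (D.toFun V) (D.add_right V)).map_zero

theorem map_sub (D : LinearConnection E N Γ) (V : VF E N) (s t : Γ) :
    D.toFun V (s - t) = D.toFun V s - D.toFun V t :=
  (AddMonoidHom.mk' (D.toFun V) (D.add_right V)).map_sub s t

theorem sub_left (D : LinearConnection E N Γ) (V W : VF E N) (s : Γ) :
    D.toFun (V - W) s = D.toFun V s - D.toFun W s :=
  (AddMonoidHom.mk' (D.toFun · s) (D.add_left · · s)).map_sub V W

theorem zero_left (D : LinearConnection E N Γ) (s : Γ) : D.toFun 0 s = 0 :=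
  (AddMonoidHom.mk' (D.toFun · s) (D.add_left · · s)).map_zero

/-- The connection induced on a submodule that is invariant under covariant differentiation. -/
def restrict (D : LinearConnection E N Γ) (S : Submodule (Fn E N) Γ)
    (hS : ∀ V, ∀ s ∈ S, D.toFun V s ∈ S) : LinearConnection E N S where
  toFun V s := ⟨D.toFun V s, hS V s s.2⟩
  add_left V W s := Subtype.ext (D.add_left V W s)
  smul_left f V s := Subtype.ext (D.smul_left f V s)
  add_right V s t := Subtype.ext (D.add_right V s t)
  leibniz V f s := Subtype.ext (D.leibniz V f s)

/-- The connection induced on the quotient by a submodule that is invariant under covariant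
differentiation. -/
def quotient (D : LinearConnection E N Γ) (S : Submodule (Fn E N) Γ)
    (hS : ∀ V, ∀ s ∈ S, D.toFun V s ∈ S) : LinearConnection E N (Γ ⧸ S) where
  toFun V := QuotientAddGroup.map S.toAddSubgroup S.toAddSubgroup
    (AddMonoidHom.mk' (D.toFun V) (D.add_right V)) (hS V)
  add_left V W := S.mkQ_surjective.forall.2 fun s => congrArg S.mkQ (D.add_left V W s)
  smul_left f V := S.mkQ_surjective.forall.2 fun s => congrArg S.mkQ (D.smul_left f V s)
  add_right _ := _root_.map_add _
  leibniz V f := S.mkQ_surjective.forall.2 fun s => congrArg S.mkQ (D.leibniz V f s)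

section Curvature

variable [FiniteDimensional ℝ E]

/-- The connection `D` is torsion free: `D_V W - D_W V = [V, W]`. -/
def IsTorsionFree (D : LinearConnection E N (VF E N)) : Prop :=
  ∀ V W, D.toFun V W - D.toFun W V = ⁅V, W⁆

/-- The bilinear form `B` is parallel for the connection `D`:
`V B(s, t) = B(D_V s, t) + B(s, D_V t)`. -/
def IsCompatible (D : LinearConnection E N Γ) (B : LinearMap.BilinForm (Fn E N) Γ) : Prop :=
  ∀ V s t, dirDeriv V (B s t) = B (D.toFun V s) t + B s (D.toFun V t)

variable [T2Space N]

/-- The curvature of a connection as an `End(Γ)`-valued tensor,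
`(V, W) ↦ D_V D_W - D_W D_V - D_[V, W]`. -/
def curvature (D : LinearConnection E N Γ) :
    VF E N →ₗ[Fn E N] VF E N →ₗ[Fn E N] Module.End (Fn E N) Γ :=
  LinearMap.mk₂ (Fn E N)
    (fun V W =>
      { toFun s := D.toFun V (D.toFun W s) - D.toFun W (D.toFun V s) - D.toFun ⁅V, W⁆ s
        map_add' s t := by
          simp only [D.add_right]
          abel
        map_smul' f s := by
          simp only [D.leibniz, D.add_right, dirDeriv_lie, RingHom.id_apply]
          module })
    (fun V V' W => LinearMap.ext fun s => by
      simp only [LinearMap.coe_mk, AddHom.coe_mk, LinearMap.add_apply, add_lie, D.add_left,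
        D.add_right]
      abel)
    (fun f V W => LinearMap.ext fun s => by
      simp only [LinearMap.coe_mk, AddHom.coe_mk, LinearMap.smul_apply, fn_smul_lie, D.sub_left,
        D.smul_left, D.leibniz]
      module)
    (fun V W W' => LinearMap.ext fun s => by
      simp only [LinearMap.coe_mk, AddHom.coe_mk, LinearMap.add_apply, lie_add, D.add_left,
        D.add_right]
      abel)
    (fun f V W => LinearMap.ext fun s => by
      simp only [LinearMap.coe_mk, AddHom.coe_mk, LinearMap.smul_apply, lie_fn_smul, D.add_left,
        D.smul_left, D.leibniz]
      module)

variable {D : LinearConnection E N Γ}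

theorem curvature_apply (V W : VF E N) (s : Γ) :
    D.curvature V W s
      = D.toFun V (D.toFun W s) - D.toFun W (D.toFun V s) - D.toFun ⁅V, W⁆ s := rfl

theorem curvature_isAlt : D.curvature.IsAlt := fun V => LinearMap.ext fun s => by
  rw [curvature_apply, lie_self, D.zero_left, sub_self, sub_zero, LinearMap.zero_apply]

theorem curvature_swap (V W : VF E N) (s : Γ) : D.curvature V W s = -D.curvature W V s :=
  (LinearMap.congr_fun (curvature_isAlt.neg W V) s).symm

theorem quotient_isFlat_iff {S : Submodule (Fn E N) Γ} {hS : ∀ V, ∀ s ∈ S, D.toFun V s ∈ S} :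
    (D.quotient S hS).IsFlat ↔ ∀ V W s, D.curvature V W s ∈ S :=
  forall₂_congr fun V W => S.mkQ_surjective.forall.trans <| forall_congr' fun s =>
    S.mkQ_apply s ▸ Submodule.Quotient.mk_eq_zero S (x := D.curvature V W s)

theorem IsCompatible.curvature_skew {B : LinearMap.BilinForm (Fn E N) Γ} (hD : D.IsCompatible B)
    (V W : VF E N) (s t : Γ) : B (D.curvature V W s) t = -B s (D.curvature V W t) := by
  have h := dirDeriv_lie V W (B s t)
  simp only [hD _ _ _, dirDeriv_add] at h
  simp only [curvature_apply, _root_.map_sub, LinearMap.sub_apply]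
  linear_combination -h

theorem IsTorsionFree.bianchi {D : LinearConnection E N (VF E N)} (hD : D.IsTorsionFree)
    (X Y V : VF E N) : D.curvature X Y V + D.curvature Y V X + D.curvature V X Y = 0 := by
  have hcurv (X Y V : VF E N) : D.curvature X Y V = D.toFun X (D.toFun Y V)
      - D.toFun Y (D.toFun X V) - (D.toFun V (D.toFun X Y) - D.toFun V (D.toFun Y X))
      + ⁅V, ⁅X, Y⁆⁆ := by
    rw [curvature_apply, ← D.map_sub, hD X Y, ← hD V]
    abel
  simp only [hcurv]
  linear_combination (norm := module) lie_jacobi X Y V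

theorem curvature_pair_symm {D : LinearConnection E N (VF E N)} (hD : D.IsTorsionFree)
    {B : LinearMap.BilinForm (Fn E N) (VF E N)} (hB : B.IsSymm) (hDB : D.IsCompatible B)
    (X Y V W : VF E N) : B (D.curvature X Y V) W = B (D.curvature V W X) Y :=
  eq_swap_pairs_of_bianchi (R := fun X Y V W => B (D.curvature X Y V) W)
    (fun X Y V W => by rw [curvature_swap, _root_.map_neg, LinearMap.neg_apply])
    (fun X Y V W => by rw [hDB.curvature_skew, hB.eq])
    (fun X Y V W => by
      rw [← LinearMap.add_apply, ← LinearMap.add_apply, ← _root_.map_add, ← _root_.map_add,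
        hD.bianchi, _root_.map_zero, LinearMap.zero_apply]) X Y V W

end Curvature

end LinearConnection

end LinearConnections

section LeviCivitaConnection

variable {E : Type*} [NormedAddCommGroup E] [NormedSpace ℝ E]
  {N : Type*} [TopologicalSpace N] [ChartedSpace E N] [IsManifold 𝓘(ℝ, E) ∞ N]

namespace LorentzianMetric

variable (g : LorentzianMetric E N)

/-- The metric as a `C^∞(N)`-bilinear form on vector fields. -/
def form : LinearMap.BilinForm (Fn E N) (VF E N) :=
  LinearMap.mk₂ (Fn E N)
    (fun X Y =>
      ⟨fun x => g.inner x (X x) (Y x), fun x =>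
        (contMDiffAt_totalSpace.1 (ContMDiffAt.clm_bundle_apply₂ (E₃ := Bundle.Trivial N ℝ)
          (F₃ := ℝ) (g.contMDiff x) (X.contMDiff x) (Y.contMDiff x))).2⟩)
    (fun X X' Y => by ext x; exact (g.inner x).map_add₂ (X x) (X' x) (Y x))
    (fun f X Y => by ext x; exact (g.inner x).map_smul₂ (f x) (X x) (Y x))
    (fun X Y Y' => by ext x; exact (g.inner x (X x)).map_add (Y x) (Y' x))
    (fun f X Y => by ext x; exact (g.inner x (X x)).map_smul (f x) (Y x))

@[simp]
theorem form_apply_apply (X Y : VF E N) (x : N) : g.form X Y x = g.inner x (X x) (Y x) := rfl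

theorem form_isSymm : g.form.IsSymm := ⟨fun X Y => by ext x; exact g.symm x (X x) (Y x)⟩

/-- The matrix of the metric at `y`, as an operator, in the tangent frame of the chart at `x₀`. -/
def inCoordinates (x₀ y : N) : E →L[ℝ] E →L[ℝ] ℝ :=
  ContinuousLinearMap.inCoordinates E (TangentSpace 𝓘(ℝ, E)) (E →L[ℝ] ℝ)
    (fun x : N => TangentSpace 𝓘(ℝ, E) x →L[ℝ] ℝ) x₀ y x₀ y (g.inner y)

theorem contMDiffAt_inCoordinates (x₀ : N) :
    ContMDiffAt 𝓘(ℝ, E) 𝓘(ℝ, E →L[ℝ] E →L[ℝ] ℝ) ∞ (g.inCoordinates x₀) x₀ :=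
  ((contMDiffAt_hom_bundle _).1 (g.contMDiff x₀)).2

variable {g} {x₀ y : N}

theorem inCoordinates_apply_apply
    (hy : y ∈ (trivializationAt E (TangentSpace 𝓘(ℝ, E)) x₀).baseSet) (a b : E) :
    g.inCoordinates x₀ y a b
      = g.inner y ((trivializationAt E (TangentSpace 𝓘(ℝ, E)) x₀).symm y a)
          ((trivializationAt E (TangentSpace 𝓘(ℝ, E)) x₀).symm y b) :=
  (inCoordinates_apply_eq₂ (E₃ := fun _ : N => ℝ) hy hy (by simp)).trans (by simp)

variable [FiniteDimensional ℝ E]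

theorem isInvertible_inCoordinates
    (hy : y ∈ (trivializationAt E (TangentSpace 𝓘(ℝ, E)) x₀).baseSet) :
    (g.inCoordinates x₀ y).IsInvertible := by
  set t := trivializationAt E (TangentSpace 𝓘(ℝ, E)) x₀
  refine isInvertible_of_separatingLeft fun a ha => ?_
  have hzero : t.symm y a = 0 := g.eq_zero_of_inner y _ fun w => by
    have hw := ha (t ⟨y, w⟩).2
    rwa [inCoordinates_apply_apply hy, t.symm_apply_apply_mk hy] at hw
  rw [← t.linearMapAt_symm (R := ℝ) hy a, hzero, map_zero]

variable (g)

/-- The right-hand side of the Koszul formula as a smooth function. -/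
def koszulFn (X Y W : VF E N) : Fn E N :=
  dirDeriv X (g.form Y W) + dirDeriv Y (g.form W X) - dirDeriv W (g.form X Y)
    + g.form ⁅X, Y⁆ W - g.form ⁅Y, W⁆ X + g.form ⁅W, X⁆ Y

theorem koszulFn_apply (X Y W : VF E N) (x : N) : g.koszulFn X Y W x = koszul g X Y W x := rfl

theorem koszulFn_add_left (X X' Y W : VF E N) :
    g.koszulFn (X + X') Y W = g.koszulFn X Y W + g.koszulFn X' Y W := by
  simp only [koszulFn, map_add, LinearMap.add_apply, dirDeriv_add, dirDeriv_add_left, add_lie,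
    lie_add]
  ring

theorem koszulFn_add_middle (X Y Y' W : VF E N) :
    g.koszulFn X (Y + Y') W = g.koszulFn X Y W + g.koszulFn X Y' W := by
  simp only [koszulFn, map_add, LinearMap.add_apply, dirDeriv_add, dirDeriv_add_left, add_lie,
    lie_add]
  ring

theorem koszulFn_smul_left (f : Fn E N) (X Y W : VF E N) :
    g.koszulFn (f • X) Y W = f * g.koszulFn X Y W := by
  simp only [koszulFn, map_smul, map_add, map_sub, LinearMap.smul_apply, LinearMap.add_apply,
    LinearMap.sub_apply, smul_eq_mul, dirDeriv_mul, dirDeriv_smul_left, fn_smul_lie, lie_fn_smul,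
    g.form_isSymm.eq W X]
  ring

theorem koszulFn_smul_middle (X : VF E N) (f : Fn E N) (Y W : VF E N) :
    g.koszulFn X (f • Y) W = f * g.koszulFn X Y W + 2 • (dirDeriv X f * g.form Y W) := by
  simp only [koszulFn, map_smul, map_add, map_sub, LinearMap.smul_apply, LinearMap.add_apply,
    LinearMap.sub_apply, smul_eq_mul, dirDeriv_mul, dirDeriv_smul_left, fn_smul_lie, lie_fn_smul,
    g.form_isSymm.eq W X, g.form_isSymm.eq Y X]
  ring

variable [T2Space N]

theorem eq_of_form_eq {A B : VF E N} (h : ∀ W, g.form A W = g.form B W) : A = B := by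
  ext x
  refine sub_eq_zero.1 (g.eq_zero_of_inner x _ fun w => ?_)
  obtain ⟨W, rfl⟩ := exists_contMDiffSection_apply_eq (I := 𝓘(ℝ, E)) (F := E) w
  simpa [sub_eq_zero] using DFunLike.congr_fun (h W) x

theorem contMDiff_of_inner {σ : (x : N) → TangentSpace 𝓘(ℝ, E) x}
    (h : ∀ W : VF E N, ContMDiff 𝓘(ℝ, E) 𝓘(ℝ, ℝ) ∞ fun x => g.inner x (σ x) (W x)) :
    CMDiff ∞ (T% σ) := by
  intro x₀
  have := FiniteDimensional.complete ℝ E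
  rw [contMDiffAt_section]
  set t := trivializationAt E (TangentSpace 𝓘(ℝ, E)) x₀ with ht
  have hbase : ∀ᶠ y in 𝓝 x₀, y ∈ t.baseSet :=
    t.open_baseSet.mem_nhds (FiberBundle.mem_baseSet_trivializationAt' x₀)
  have hlower : ContMDiffAt 𝓘(ℝ, E) 𝓘(ℝ, E →L[ℝ] ℝ) ∞
      (fun y => g.inCoordinates x₀ y (t ⟨y, σ y⟩).2) x₀ := by
    refine contMDiffAt_clm_of_apply fun w => ?_
    obtain ⟨W, hW⟩ := exists_contMDiffSection_eventuallyEq_extend (I := 𝓘(ℝ, E)) (F := E)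
      (t.symm x₀ w)
    refine (h W x₀).congr_of_eventuallyEq ?_
    filter_upwards [hW, hbase] with y hWy hy
    rw [inCoordinates_apply_apply hy, hWy, FiberBundle.extend, ← ht,
      t.apply_mk_symm hbase.self_of_nhds, t.symm_apply_apply_mk hy]
  have hinverse : ContMDiffAt 𝓘(ℝ, E) 𝓘(ℝ, (E →L[ℝ] ℝ) →L[ℝ] E) ∞
      (fun y => (g.inCoordinates x₀ y).inverse) x₀ :=
    (isInvertible_inCoordinates hbase.self_of_nhds).contDiffAt_map_inverse.contMDiffAt.comp x₀
      (g.contMDiffAt_inCoordinates x₀)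
  refine (hinverse.clm_apply hlower).congr_of_eventuallyEq ?_
  filter_upwards [hbase] with y hy
  exact ((isInvertible_inCoordinates hy).inverse_apply_eq.2 rfl).symm

/-- The Levi-Civita covariant derivative as a smooth vector field. -/
def nabla (X Y : VF E N) : VF E N :=
  ⟨leviCivita g X Y, g.contMDiff_of_inner fun W => by
    refine ((1 / 2 : ℝ) • g.koszulFn X Y W).contMDiff.congr fun x => ?_
    have hspec := leviCivita_spec g X.mdifferentiableAt Y.mdifferentiableAt W.mdifferentiableAt
      (x := x)
    rw [ContMDiffMap.coe_smul, Pi.smul_apply, koszulFn_apply, ← hspec, smul_eq_mul]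
    ring⟩

theorem two_nsmul_form_nabla (X Y W : VF E N) :
    2 • g.form (g.nabla X Y) W = g.koszulFn X Y W := by
  ext x
  have hspec := leviCivita_spec g X.mdifferentiableAt Y.mdifferentiableAt W.mdifferentiableAt
    (x := x)
  rw [koszulFn_apply, ← hspec, two_nsmul, two_mul]
  rfl

variable {g} in
theorem nabla_eq_of_koszul {X Y A : VF E N} (hA : ∀ W, g.koszulFn X Y W = 2 • g.form A W) :
    g.nabla X Y = A :=
  g.eq_of_form_eq fun W =>
    nsmul_right_injective two_ne_zero ((g.two_nsmul_form_nabla X Y W).trans (hA W))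

/-- The Levi-Civita connection on the module of vector fields. -/
def leviCivitaConnection : LinearConnection E N (VF E N) where
  toFun := g.nabla
  add_left X X' Y := nabla_eq_of_koszul fun W => by
    rw [koszulFn_add_left, map_add, LinearMap.add_apply, nsmul_add, two_nsmul_form_nabla,
      two_nsmul_form_nabla]
  smul_left f X Y := nabla_eq_of_koszul fun W => by
    rw [koszulFn_smul_left, map_smul, LinearMap.smul_apply, smul_comm, two_nsmul_form_nabla,
      smul_eq_mul]
  add_right X Y Y' := nabla_eq_of_koszul fun W => by
    rw [koszulFn_add_middle, map_add, LinearMap.add_apply, nsmul_add, two_nsmul_form_nabla,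
      two_nsmul_form_nabla]
  leibniz X f Y := nabla_eq_of_koszul fun W => by
    rw [koszulFn_smul_middle, map_add, map_smul, map_smul, LinearMap.add_apply,
      LinearMap.smul_apply, LinearMap.smul_apply, nsmul_add, smul_comm, two_nsmul_form_nabla,
      smul_eq_mul, smul_eq_mul]

theorem leviCivitaConnection_isTorsionFree : g.leviCivitaConnection.IsTorsionFree :=
  fun X Y => by ext x; exact leviCivita_torsion g X Y x

theorem leviCivitaConnection_isCompatible : g.leviCivitaConnection.IsCompatible g.form :=
  fun X Y W => by ext x; exact leviCivita_metric g X Y W x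

theorem leviCivitaConnection_curvature_apply (X Y V : VF E N) (x : N) :
    g.leviCivitaConnection.curvature X Y V x = PPWave.curvature g X Y V x := rfl

theorem form_curvature_pair_symm (X Y V W : VF E N) :
    g.form (g.leviCivitaConnection.curvature X Y V) W
      = g.form (g.leviCivitaConnection.curvature V W X) Y :=
  LinearConnection.curvature_pair_symm g.leviCivitaConnection_isTorsionFree g.form_isSymm
    g.leviCivitaConnection_isCompatible X Y V W

end LorentzianMetric

theorem curvatureVanishesOnPerp_iff [FiniteDimensional ℝ E] [T2Space N] {g : LorentzianMetric E N}
    {Z : VF E N} : CurvatureVanishesOnPerp g Z ↔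
      ∀ X ∈ perp g Z, ∀ Y ∈ perp g Z, g.leviCivitaConnection.curvature X Y = 0 :=
  forall₄_congr fun X _ Y _ =>
    ⟨fun h => by ext V x; exact h V x, fun h V x => DFunLike.congr_fun (LinearMap.congr_fun h V) x⟩

end LeviCivitaConnection

section Reduction

variable {R M : Type*} [CommRing R] [AddCommGroup M] [Module R M] {B : LinearMap.BilinForm R M}
  {S : Submodule R M} {z : M}

theorem span_singleton_submoduleOf_le_ker_restrict (h : ∀ s ∈ S, B z s = 0) :
    (Submodule.span R {z}).submoduleOf S ≤ (B.restrict S).ker := by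
  rintro ⟨s, hs⟩ hsz
  obtain ⟨c, rfl⟩ := Submodule.mem_span_singleton.1 hsz
  ext ⟨t, ht⟩
  change B (c • z) t = 0
  rw [map_smul, LinearMap.smul_apply, h t ht, smul_zero]

/-- The form induced by a symmetric bilinear form on the quotient by `z` of a submodule orthogonal
to `z`. -/
def reducedForm (hB : B.IsSymm) (h : ∀ s ∈ S, B z s = 0) :
    LinearMap.BilinForm R (S ⧸ (Submodule.span R {z}).submoduleOf S) :=
  LinearMap.IsRefl.liftQ₂ (B.restrict S) _ (fun s t hst => (hB.eq s t).symm.trans hst)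
    (span_singleton_submoduleOf_le_ker_restrict h)

theorem reducedForm_isSymm (hB : B.IsSymm) (h : ∀ s ∈ S, B z s = 0) : (reducedForm hB h).IsSymm :=
  ⟨(Submodule.mkQ_surjective _).forall₂.2 fun s t => hB.eq s t⟩

end Reduction

section NullVectors

variable {E : Type*} [NormedAddCommGroup E] [NormedSpace ℝ E]
  {N : Type*} [TopologicalSpace N] [ChartedSpace E N] [IsManifold 𝓘(ℝ, E) ∞ N]
  {g : LorentzianMetric E N} {Z : VF E N}

theorem LorentzianMetric.exists_eq_smul_or_inner_pos {x : N} {z w : TangentSpace 𝓘(ℝ, E) x}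
    (hz : z ≠ 0) (hzz : g.inner x z z = 0) (hw : g.inner x w z = 0) :
    (∃ c : ℝ, w = c • z) ∨ 0 < g.inner x w w := by
  obtain ⟨v, -, hv⟩ := g.signature x
  have hvz : g.inner x v z ≠ 0 := fun h => (hv z h hz).ne' hzz
  -- Subtracting a multiple of `z` makes `w` orthogonal to the timelike vector `v` without changing
  -- its square.
  set c : ℝ := g.inner x v w / g.inner x v z
  have hv_orth : g.inner x v (w - c • z) = 0 := by
    rw [map_sub, map_smul, smul_eq_mul, div_mul_cancel₀ _ hvz, sub_self]
  have hsq : g.inner x (w - c • z) (w - c • z) = g.inner x w w := by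
    simp [hw, hzz, (g.symm x z w).trans hw]
  by_cases hwz : w - c • z = 0
  · exact Or.inl ⟨c, sub_eq_zero.1 hwz⟩
  · exact Or.inr (hsq ▸ hv _ hv_orth hwz)

theorem IsNull.exists_eq_smul (hZ : IsNull g Z) {x : N} {w : TangentSpace 𝓘(ℝ, E) x}
    (hw : g.inner x w (Z x) = 0) (hww : g.inner x w w = 0) : ∃ c : ℝ, w = c • Z x :=
  (g.exists_eq_smul_or_inner_pos (hZ x).1 (hZ x).2 hw).resolve_right hww.not_gt

theorem mem_perp_iff {X : VF E N} : X ∈ perp g Z ↔ g.form X Z = 0 :=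
  (DFunLike.ext_iff (f := g.form X Z) (g := 0)).symm

theorem IsNull.mem_span_of_form_self_eq_zero (hZ : IsNull g Z) {A : VF E N} (hA : A ∈ perp g Z)
    (hAA : g.form A A = 0) : A ∈ Submodule.span (Fn E N) {Z} := by
  choose f hf using fun x => hZ.exists_eq_smul (hA x) (DFunLike.congr_fun hAA x)
  have hA_eq : ⇑A = f • ⇑Z := funext hf
  refine Submodule.mem_span_singleton.2 ⟨⟨f, fun x => ?_⟩, by ext x; exact (hf x).symm⟩
  exact contMDiffAt_of_smul_section (Z.contMDiff x) (hA_eq ▸ A.contMDiff x) (hZ x).1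

end NullVectors

section WavefrontMetric

variable {E : Type*} [NormedAddCommGroup E] [NormedSpace ℝ E]
  {N : Type*} [TopologicalSpace N] [ChartedSpace E N] [IsManifold 𝓘(ℝ, E) ∞ N]
  (g : LorentzianMetric E N) (Z : VF E N)

/-- The metric induced on the fibre of the wavefront bundle at `x`. -/
def wavefrontInnerAt (x : N) : LinearMap.BilinForm ℝ (WavefrontAt g Z x) :=
  reducedForm (B := (g.inner x).toBilinForm) ⟨g.symm x⟩ fun v hv => (g.symm x (Z x) v).trans hv

theorem wavefrontInnerAt_clsAt (x : N) (v w : perpAt g Z x) :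
    wavefrontInnerAt g Z x (clsAt g Z v) (clsAt g Z w) = g.inner x v w := rfl

theorem wavefrontInnerAt_isSymm (x : N) : (wavefrontInnerAt g Z x).IsSymm := reducedForm_isSymm _ _

variable {g Z} in
theorem wavefrontInnerAt_pos (hZ : IsNull g Z) {x : N} {ξ : WavefrontAt g Z x} (hξ : ξ ≠ 0) :
    0 < wavefrontInnerAt g Z x ξ ξ := by
  obtain ⟨v, rfl⟩ := Submodule.Quotient.mk_surjective _ ξ
  refine (g.exists_eq_smul_or_inner_pos (hZ x).1 (hZ x).2 v.2).resolve_left ?_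
  rintro ⟨c, hc⟩
  exact hξ ((Submodule.Quotient.mk_eq_zero _).2 (Submodule.mem_span_singleton.2 ⟨c, hc.symm⟩))

/-- The metric induced on the sections of the wavefront bundle. -/
def wavefrontInner : LinearMap.BilinForm (Fn E N) (Wavefront g Z) :=
  reducedForm g.form_isSymm fun X hX => (g.form_isSymm.eq X Z).symm.trans (mem_perp_iff.1 hX)

theorem wavefrontInner_cls_apply (X Y : perp g Z) (x : N) :
    wavefrontInner g Z (cls g Z X) (cls g Z Y) x = g.inner x (X.1 x) (Y.1 x) := rfl

end WavefrontMetric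

section WavefrontConnection

variable {E : Type*} [NormedAddCommGroup E] [NormedSpace ℝ E] [FiniteDimensional ℝ E]
  {N : Type*} [TopologicalSpace N] [T2Space N] [ChartedSpace E N] [IsManifold 𝓘(ℝ, E) ∞ N]
  {g : LorentzianMetric E N} {Z : VF E N}

namespace IsParallel

variable (hZ : IsParallel g Z)

include hZ

theorem leviCivitaConnection_eq_zero (V : VF E N) : g.leviCivitaConnection.toFun V Z = 0 := by
  ext x
  exact hZ V x

theorem leviCivitaConnection_mem_perp (V : VF E N) {Y : VF E N} (hY : Y ∈ perp g Z) :
    g.leviCivitaConnection.toFun V Y ∈ perp g Z := by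
  rw [mem_perp_iff] at hY ⊢
  simpa [hY, hZ.leviCivitaConnection_eq_zero, dirDeriv_zero] using
    (g.leviCivitaConnection_isCompatible V Y Z).symm

theorem leviCivitaConnection_mem_span (V : VF E N) {Y : VF E N}
    (hY : Y ∈ Submodule.span (Fn E N) {Z}) :
    g.leviCivitaConnection.toFun V Y ∈ Submodule.span (Fn E N) {Z} := by
  obtain ⟨f, rfl⟩ := Submodule.mem_span_singleton.1 hY
  rw [g.leviCivitaConnection.leibniz, hZ.leviCivitaConnection_eq_zero, smul_zero, zero_add]
  exact Submodule.smul_mem _ _ (Submodule.mem_span_singleton_self Z)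

theorem curvature_apply_eq_zero (V W : VF E N) : g.leviCivitaConnection.curvature V W Z = 0 := by
  simp only [LinearConnection.curvature_apply, hZ.leviCivitaConnection_eq_zero,
    LinearConnection.map_zero, sub_zero]

theorem curvature_right_eq_zero (V : VF E N) : g.leviCivitaConnection.curvature V Z = 0 := by
  ext1 W
  refine g.eq_of_form_eq fun T => ?_
  rw [g.form_curvature_pair_symm, g.leviCivitaConnection_isCompatible.curvature_skew,
    hZ.curvature_apply_eq_zero]
  simp

end IsParallel

/-- The connection induced by the Levi-Civita connection on the sections of the wavefront bundle of
a parallel vector field. -/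
def wavefrontConnection (hZ : IsParallel g Z) : LinearConnection E N (Wavefront g Z) :=
  (g.leviCivitaConnection.restrict (perp g Z)
    fun V _ => hZ.leviCivitaConnection_mem_perp V).quotient _
    fun V _ => hZ.leviCivitaConnection_mem_span V

theorem wavefrontConnection_cls (hZ : IsParallel g Z) (V : VF E N) (Y : perp g Z) :
    (wavefrontConnection hZ).toFun V (cls g Z Y)
      = cls g Z ⟨g.leviCivitaConnection.toFun V Y, hZ.leviCivitaConnection_mem_perp V Y.2⟩ := rfl

theorem wavefrontConnection_isFlat_iff (hZ : IsParallel g Z) :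
    (wavefrontConnection hZ).IsFlat ↔ ∀ V W, ∀ Y ∈ perp g Z,
      g.leviCivitaConnection.curvature V W Y ∈ Submodule.span (Fn E N) {Z} :=
  LinearConnection.quotient_isFlat_iff.trans <| forall₂_congr fun _ _ => Subtype.forall

theorem curvatureVanishesOnPerp_iff_curvature_mem_span (hnull : IsNull g Z)
    (hpar : IsParallel g Z) :
    CurvatureVanishesOnPerp g Z ↔ ∀ V W, ∀ Y ∈ perp g Z,
      g.leviCivitaConnection.curvature V W Y ∈ Submodule.span (Fn E N) {Z} := by
  rw [curvatureVanishesOnPerp_iff]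
  constructor
  · intro h V W Y hY
    have hmem : g.leviCivitaConnection.curvature V W Y ∈ perp g Z := by
      rw [mem_perp_iff, g.leviCivitaConnection_isCompatible.curvature_skew,
        hpar.curvature_apply_eq_zero, map_zero, neg_zero]
    refine hnull.mem_span_of_form_self_eq_zero hmem ?_
    rw [g.form_curvature_pair_symm, h Y hY _ hmem]
    simp
  · intro h X hX Y hY
    ext1 V
    refine g.eq_of_form_eq fun W => ?_
    obtain ⟨f, hf⟩ := Submodule.mem_span_singleton.1 (h V W X hX)
    rw [g.form_curvature_pair_symm, ← hf, map_smul, LinearMap.smul_apply, g.form_isSymm.eq,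
      mem_perp_iff.1 hY]
    simp

theorem wavefrontConnection_isFlat_iff_curvatureVanishesOnPerp (hnull : IsNull g Z)
    (hpar : IsParallel g Z) :
    (wavefrontConnection hpar).IsFlat ↔ CurvatureVanishesOnPerp g Z :=
  (wavefrontConnection_isFlat_iff hpar).trans
    (curvatureVanishesOnPerp_iff_curvature_mem_span hnull hpar).symm

theorem LorentzianMetric.exists_inner_ne_zero (g : LorentzianMetric E N) {x : N}
    {v : TangentSpace 𝓘(ℝ, E) x} (hv : v ≠ 0) : ∃ T : VF E N, g.inner x v (T x) ≠ 0 := by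
  contrapose! hv
  refine g.eq_zero_of_inner x v fun w => ?_
  obtain ⟨T, rfl⟩ := exists_contMDiffSection_apply_eq (I := 𝓘(ℝ, E)) (F := E) w
  exact hv T

namespace CurvatureVanishesOnPerp

theorem smul_smul_curvature (h : CurvatureVanishesOnPerp g Z) (T X Y : VF E N) :
    g.form Z T • g.form Z T • g.leviCivitaConnection.curvature X Y
      = g.form Z T • (g.form Z Y • g.leviCivitaConnection.curvature X T
          + g.form Z X • g.leviCivitaConnection.curvature T Y) := by
  have hproj (A : VF E N) : g.form Z T • A - g.form Z A • T ∈ perp g Z := by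
    rw [mem_perp_iff, g.form_isSymm.eq]
    simp [mul_comm]
  have hzero := curvatureVanishesOnPerp_iff.1 h _ (hproj X) _ (hproj Y)
  simp only [map_sub, map_smul, LinearMap.sub_apply, LinearMap.smul_apply,
    LinearConnection.curvature_isAlt.self_eq_zero] at hzero
  linear_combination (norm := module) hzero

theorem curvature_apply_eq_zero (h : CurvatureVanishesOnPerp g Z) {x : N} (hx : Z x ≠ 0)
    {X Y : VF E N} (hX : g.inner x (Z x) (X x) = 0) (hY : g.inner x (Z x) (Y x) = 0) (V : VF E N) :
    g.leviCivitaConnection.curvature X Y V x = 0 := by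
  obtain ⟨T, hT⟩ := g.exists_inner_ne_zero hx
  simpa [hX, hY, hT] using
    DFunLike.congr_fun (LinearMap.congr_fun (h.smul_smul_curvature T X Y) V) x

theorem of_isParallel_of_isNull {Z' : VF E N} (h : CurvatureVanishesOnPerp g Z')
    (hnull' : IsNull g Z') (hnull : IsNull g Z) (hpar : IsParallel g Z) :
    CurvatureVanishesOnPerp g Z := by
  intro X hX Y hY V x
  rw [← g.leviCivitaConnection_curvature_apply]
  by_cases hx : g.inner x (Z' x) (Z x) = 0
  · obtain ⟨c, hc⟩ := hnull.exists_eq_smul hx (hnull' x).2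
    have horth {A : VF E N} (hA : A ∈ perp g Z) : g.inner x (Z' x) (A x) = 0 := by
      rw [g.symm, hc, map_smul, hA x, smul_zero]
    exact h.curvature_apply_eq_zero (hnull' x).1 (horth hX) (horth hY) V
  · -- Here `Z_x` spans a complement of `Z'_⊥`, and `Z` annihilates the curvature.
    have hZ_left : g.leviCivitaConnection.curvature Z Y = 0 := by
      rw [← LinearConnection.curvature_isAlt.neg, hpar.curvature_right_eq_zero, neg_zero]
    simpa [hx, hZ_left, hpar.curvature_right_eq_zero] using
      DFunLike.congr_fun (LinearMap.congr_fun (h.smul_smul_curvature Z X Y) V) x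

end CurvatureVanishesOnPerp

theorem wavefrontConnection_isFlat_iff_isPPWave (hnull : IsNull g Z) (hpar : IsParallel g Z) :
    (wavefrontConnection hpar).IsFlat ↔ IsPPWave g :=
  (wavefrontConnection_isFlat_iff_curvatureVanishesOnPerp hnull hpar).trans
    ⟨fun h => ⟨Z, hnull, hpar, h⟩,
      fun ⟨_, hnull', _, h⟩ => h.of_isParallel_of_isNull hnull' hnull hpar⟩

end WavefrontConnection

end PPWave

end

theorem theorem4p2 {E : Type*} [NormedAddCommGroup E] [NormedSpace ℝ E] [FiniteDimensional ℝ E]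
    {M : Type*} [TopologicalSpace M] [T2Space M] [ChartedSpace E M] [IsManifold 𝓘(ℝ, E) ∞ M]
    (g : LorentzianMetric E M) (U : TopologicalSpace.Opens M) (Z : VF E U)
    (hnull : IsNull (g.restrict U) Z) (hpar : IsParallel (g.restrict U) Z) :
    ∃ (gbar : ∀ x : U, LinearMap.BilinForm ℝ (WavefrontAt (g.restrict U) Z x))
      (Gbar : Wavefront (g.restrict U) Z →ₗ[Fn E U]
        Wavefront (g.restrict U) Z →ₗ[Fn E U] Fn E U)
      (nbar : LinearConnection E U (Wavefront (g.restrict U) Z)),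
      -- the fibrewise positive-definite inner product induced by the metric
      (∀ (x : U) (v w : perpAt (g.restrict U) Z x),
        gbar x (clsAt (g.restrict U) Z v) (clsAt (g.restrict U) Z w)
          = (g.restrict U).inner x v w) ∧
      (∀ (x : U) (ξ η : WavefrontAt (g.restrict U) Z x), gbar x ξ η = gbar x η ξ) ∧
      (∀ (x : U) (ξ : WavefrontAt (g.restrict U) Z x), ξ ≠ 0 → 0 < gbar x ξ ξ) ∧
      -- it depends smoothly on the point: the product of two sections is a smooth function
      (∀ (X Y : perp (g.restrict U) Z) (x : U),
        Gbar (cls (g.restrict U) Z X) (cls (g.restrict U) Z Y) x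
          = gbar x (clsAt (g.restrict U) Z (evalAt (g.restrict U) Z X x))
              (clsAt (g.restrict U) Z (evalAt (g.restrict U) Z Y x))) ∧
      -- the induced connection: the derivative of a section of the orthogonal bundle is again one
      (∀ (V : VF E U) (Y : perp (g.restrict U) Z),
        ∃ DY : perp (g.restrict U) Z,
          (∀ x : U, DY.1 x = leviCivita (g.restrict U) V Y.1 x) ∧
          nbar.toFun V (cls (g.restrict U) Z Y) = cls (g.restrict U) Z DY) ∧
      -- flatness
      (nbar.IsFlat ↔ CurvatureVanishesOnPerp (g.restrict U) Z) ∧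
      (nbar.IsFlat ↔ IsPPWave (g.restrict U)) := by
  refine ⟨wavefrontInnerAt (g.restrict U) Z, wavefrontInner (g.restrict U) Z,
    wavefrontConnection hpar, wavefrontInnerAt_clsAt (g.restrict U) Z,
    fun x => (wavefrontInnerAt_isSymm (g.restrict U) Z x).eq,
    fun x ξ hξ => wavefrontInnerAt_pos hnull hξ, wavefrontInner_cls_apply (g.restrict U) Z,
    fun V Y => ⟨_, fun x => rfl, wavefrontConnection_cls hpar V Y⟩,
    wavefrontConnection_isFlat_iff_curvatureVanishesOnPerp hnull hpar,
    wavefrontConnection_isFlat_iff_isPPWave hnull hpar⟩
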